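/- **Setting.** Let $2\le\nu\le n$ and let $\Omega\subset\mathbb C^n$ be a domain with smooth boundary and defining function $r$: $r$ is real-valued and smooth near $b\Omega$, there $\Omega=\{r<0\}$, and $dr\neq0$ on $b\Omega$. **Commutator multitype at $x\in b\Omega$.** Let $p$ be the rank at $x$ of the Levi form $\partial\bar\partial r$ on $T^{(1,0)}_x(b\Omega)=\{\partial r=0\}$. Put $c_1=1$ and $c_2=\dots=c_{p+1}=2$. Choose smooth $(1,0)$ vector fields $L_2,\dots,L_{p+1}$ near $x$ with $L_i(r)\equiv0$ and with $\big(\partial\bar\partial r(L_i,\bar L_j)(x)\big)_{2\le i,j\le p+1}$ nonsingular. For $k=p+2,p+3,\dots$ proceed inductively. * Let $\mathcal T_k$ be the set of germs at $x$ of smooth $(1,0)$ vector fields $L$ such that, near $x$, $L(r)=0$, $\partial\bar\partial r(L,\bar L_j)=0$ for $2\le j\le p+1$, and $L(r_i)=0$ for $p+2\le i<k$. * For $L\in\mathcal T_k$ consider lists $\mathcal L=\{L^1,\dots,L^l\}$, $l\ge3$, whose members are taken from $L,\bar L$ and $L_i,\bar L_i$ $(p+2\le i<k)$. Let $l_k$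 be the number of members equal to $L$ or $\bar L$, and $l_i$ the number equal to $L_i$ or $\bar L_i$. The list must be *ordered*: first come all members $L,\bar L$, then all members $L_{k-1},\bar L_{k-1}$, then all members $L_{k-2},\bar L_{k-2}$, and so on. It must also be *$k$-admissible*: $l_k>0$ and $\sum_{i=p+2}^{k-1}l_i/c_i<1$. Put $\mathcal L\partial r=L^1\cdots L^{l-2}\,\partial r([L^{l-1},L^l])$, and let $c(\mathcal L)$ be the solution of $\sum_{i=p+2}^{k-1}l_i/c_i+l_k/c(\mathcal L)=1$. * If $\mathcal L\partial r(x)=0$ for all $L\in\mathcal T_k$ and all such lists, set $c_i=\infty$ for all $i\ge k$ and stop. Otherwise let $c_k$ be the minimum of $c(\mathcal L)$ over all such lists with $\mathcal L\partial r(x)\ne0$. Choose a list $\mathcal L_k$ attaining it, let $L_k$ be the field $L$ used in it, and let $r_k$ be the real or the imaginary part of $\mathcal L_k'\partial r$, where $\mathcal L_k'$ is $\mathcal L_k$ without its first member, chosen so that $L_k(r_k)(x)\ne0$. The resulting $\mathfrak C^\nu(x)=(c_1,\dots,c_\nu)$, a tuple with entries in $\mathbb Q\cup\{+\infty\}$,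 is called a $\nu$-th commutator multitype at $x$. Such tuples are ordered lexicographically. At each boundary point the choices in the construction may be made in any way; $\mathfrak C^\nu(x)$ is the tuple obtained. **Lemma.** Let $x_0\in b\Omega$ have an open neighborhood $\tilde U$ such that the $\nu$-th commutator multitype assumes on $\tilde U\cap b\Omega$ exactly the finitely many values $\mathfrak C^\nu_1<\mathfrak C^\nu_2<\dots<\mathfrak C^\nu_N$, $N\ge1$, and let $S_j=\{x\in\tilde U\cap b\Omega : \mathfrak C^\nu(x)=\mathfrak C^\nu_j\}$. Then the level set $S_1$ of the lowest commutator multitype is open in $b\Omega$. -/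

import Mathlib

open Complex Filter Topology
open scoped ContDiff ComplexConjugate

noncomputable section

/-- The space `ℂⁿ`. -/
abbrev Cn (n : ℕ) : Type := Fin n → ℂ

/-- The Wirtinger derivative `∂u/∂z_j = ½ (∂u/∂x_j - i ∂u/∂y_j)`. -/
def dz {n : ℕ} (j : Fin n) (u : Cn n → ℂ) (z : Cn n) : ℂ :=
  (1 / 2) * (fderiv ℝ u z (Pi.single j 1) - I * fderiv ℝ u z (Pi.single j I))

/-- The Wirtinger derivative `∂u/∂z̄_j = ½ (∂u/∂x_j + i ∂u/∂y_j)`. -/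
def dzbar {n : ℕ} (j : Fin n) (u : Cn n → ℂ) (z : Cn n) : ℂ :=
  (1 / 2) * (fderiv ℝ u z (Pi.single j 1) + I * fderiv ℝ u z (Pi.single j I))

/-- A real function regarded as a complex-valued one. -/
def toC {n : ℕ} (r : Cn n → ℝ) : Cn n → ℂ := fun z => (r z : ℂ)

/-- `f` is smooth in a neighbourhood of `x`. -/
def SmoothNear {n : ℕ} {F : Type*} [NormedAddCommGroup F] [NormedSpace ℝ F]
    (f : Cn n → F) (x : Cn n) : Prop :=
  ∀ᶠ y in 𝓝 x, ContDiffAt ℝ ∞ f y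

/-- `r` is a defining function of `Ω` with smooth boundary: it is smooth on an open neighbourhood
`W` of the boundary, `Ω` is `{r < 0}` there, and `dr` does not vanish on the boundary. -/
def IsDefiningFunction {n : ℕ} (Ω : Set (Cn n)) (r : Cn n → ℝ) : Prop :=
  ∃ W : Set (Cn n), IsOpen W ∧ frontier Ω ⊆ W ∧ ContDiffOn ℝ ∞ r W ∧
    Ω ∩ W = {z ∈ W | r z < 0} ∧ ∀ z ∈ frontier Ω, fderiv ℝ r z ≠ 0

/-- A complex vector field `∑ hol_j ∂/∂z_j + ∑ anti_j ∂/∂z̄_j`. -/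
structure CVectorField (n : ℕ) where
  hol : Cn n → Cn n
  anti : Cn n → Cn n

namespace CVectorField

/-- The action of a complex vector field on functions. -/
def apply {n : ℕ} (X : CVectorField n) (u : Cn n → ℂ) (z : Cn n) : ℂ :=
  ∑ j, (X.hol z j * dz j u z + X.anti z j * dzbar j u z)

/-- The commutator `[X, Y]`. -/
def bracket {n : ℕ} (X Y : CVectorField n) : CVectorField n where
  hol := fun z j => X.apply (fun w => Y.hol w j) z - Y.apply (fun w => X.hol w j) z
  anti := fun z j => X.apply (fun w => Y.anti w j) z - Y.apply (fun w => X.anti w j) z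

/-- The `(1,0)` vector field `∑ a_j ∂/∂z_j`. -/
def ofHol {n : ℕ} (a : Cn n → Cn n) : CVectorField n := ⟨a, 0⟩

/-- The conjugate `∑ ā_j ∂/∂z̄_j` of the `(1,0)` vector field `∑ a_j ∂/∂z_j`. -/
def ofHolConj {n : ℕ} (a : Cn n → Cn n) : CVectorField n := ⟨0, fun z j => conj (a z j)⟩

/-- `L` (for `false`) or `L̄` (for `true`), where `L = ∑ a_j ∂/∂z_j`. -/
def signed {n : ℕ} (a : Cn n → Cn n) : Bool → CVectorField n
  | false => ofHol a
  | true => ofHolConj a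

end CVectorField

/-- The form `∂r` evaluated on a complex vector field. -/
def delForm {n : ℕ} (r : Cn n → ℝ) (X : CVectorField n) (z : Cn n) : ℂ :=
  ∑ j, dz j (toC r) z * X.hol z j

/-- `∂∂̄r (∑ a_j ∂/∂z_j, ∑ b̄_k ∂/∂z̄_k)` at the point `z`. -/
def leviForm {n : ℕ} (r : Cn n → ℝ) (z : Cn n) (a b : Cn n) : ℂ :=
  ∑ j, ∑ k, dz j (dzbar k (toC r)) z * a j * conj (b k)

/-- The `(1,0)` vectors at `z` that are annihilated by `∂r`, that is, the space `T^{(1,0)}_z(bΩ)`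
when `r` is a defining function and `z` a boundary point. -/
def holTangent {n : ℕ} (r : Cn n → ℝ) (z : Cn n) : Submodule ℂ (Cn n) where
  carrier := {a | ∑ j, dz j (toC r) z * a j = 0}
  add_mem' := by
    intro a b ha hb
    simp only [Set.mem_ofPred_eq, Pi.add_apply, mul_add, Finset.sum_add_distrib] at *
    rw [ha, hb, add_zero]
  zero_mem' := by simp
  smul_mem' := by
    intro c a ha
    simp only [Set.mem_ofPred_eq, Pi.smul_apply, smul_eq_mul] at *
    simp only [mul_left_comm _ c, ← Finset.mul_sum, ha, mul_zero]

/-- The null space of the Levi form on `T^{(1,0)}_z(bΩ)`. -/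
def leviNull {n : ℕ} (r : Cn n → ℝ) (z : Cn n) : Submodule ℂ (Cn n) where
  carrier := {a | a ∈ holTangent r z ∧ ∀ b ∈ holTangent r z, leviForm r z a b = 0}
  add_mem' := by
    rintro a b ⟨ha, ha'⟩ ⟨hb, hb'⟩
    refine ⟨add_mem ha hb, fun d hd => ?_⟩
    have h : leviForm r z (a + b) d = leviForm r z a d + leviForm r z b d := by
      simp only [leviForm, Pi.add_apply, mul_add, add_mul, Finset.sum_add_distrib]
    rw [h, ha' d hd, hb' d hd, add_zero]
  zero_mem' := ⟨zero_mem _, fun b _ => by simp [leviForm]⟩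
  smul_mem' := by
    rintro c a ⟨ha, ha'⟩
    refine ⟨Submodule.smul_mem _ c ha, fun d hd => ?_⟩
    have h : leviForm r z (c • a) d = c * leviForm r z a d := by
      simp only [leviForm, Pi.smul_apply, smul_eq_mul, Finset.mul_sum]
      refine Finset.sum_congr rfl fun j _ => Finset.sum_congr rfl fun k _ => ?_
      ring
    rw [h, ha' d hd, mul_zero]

/-- The rank of the Levi form: the codimension of its null space in `T^{(1,0)}_z(bΩ)`. -/
def leviRank {n : ℕ} (r : Cn n → ℝ) (z : Cn n) : ℕ :=
  Module.finrank ℂ (holTangent r z) - Module.finrank ℂ (leviNull r z)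

/-- For a list `{L¹, …, Lˡ}` of vector fields with `l ≥ 2`, the function
`L¹ ⋯ Lˡ⁻² ∂r([Lˡ⁻¹, Lˡ])`. Shorter lists do not occur below. -/
def listDeriv {n : ℕ} (r : Cn n → ℝ) : List (CVectorField n) → Cn n → ℂ
  | [] => 0
  | [_] => 0
  | [X, Y] => delForm r (X.bracket Y)
  | X :: Y :: Z :: t => X.apply (listDeriv r (Y :: Z :: t))

/-- A word in the symbols `L_i`, `L̄_i`: the letter `(i, false)` stands for `L_i` and the letter
`(i, true)` for `L̄_i`. -/
abbrev FieldWord : Type := List (ℕ × Bool)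

namespace FieldWord

/-- The list of vector fields spelled by a word. -/
def fields {n : ℕ} (L : ℕ → Cn n → Cn n) (w : FieldWord) : List (CVectorField n) :=
  w.map fun a => CVectorField.signed (L a.1) a.2

/-- The number `l_i` of occurrences of `L_i` and `L̄_i` together. -/
def mult (i : ℕ) (w : FieldWord) : ℕ := w.countP fun a => a.1 = i

/-- The sum `∑_{i=p+2}^{k-1} l_i / c_i`. -/
def weightSum (p k : ℕ) (c : ℕ → ℚ) (w : FieldWord) : ℚ :=
  ∑ i ∈ Finset.Ico (p + 2) k, (mult i w : ℚ) / c i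

/-- Ordered, `k`-admissible lists of length at least three, made of `L_{p+2}, …, L_k` and their
conjugates: reading from left to right the indices do not increase, the last field `L_k` or its
conjugate occurs, and `∑_{i=p+2}^{k-1} l_i / c_i < 1`. -/
structure IsOrderedAdmissible (p k : ℕ) (c : ℕ → ℚ) (w : FieldWord) : Prop where
  three_le_length : 3 ≤ w.length
  index_mem : ∀ a ∈ w, p + 2 ≤ a.1 ∧ a.1 ≤ k
  ordered : w.Pairwise fun a b => b.1 ≤ a.1
  mult_pos : 0 < mult k w
  weightSum_lt : weightSum p k c w < 1

/-- The solution `c(ℒ)` of `∑_{i=p+2}^{k-1} l_i / c_i + l_k / c(ℒ) = 1`. -/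
def listWeight (p k : ℕ) (c : ℕ → ℚ) (w : FieldWord) : ℚ :=
  (mult k w : ℚ) / (1 - weightSum p k c w)

end FieldWord

/-- The vector field `∑ a_j ∂/∂z_j` represents a germ in `𝒯_k` at `x`: near `x` it is smooth, and
there `L(r) = 0`, `∂∂̄r(L, L̄_j) = 0` for `2 ≤ j ≤ p + 1`, and `L(r_i) = 0` for `p + 2 ≤ i < k`.
Here `R i` is the function `r_i`. -/
structure IsSectionNear {n : ℕ} (r : Cn n → ℝ) (x : Cn n) (p k : ℕ)
    (R : ℕ → Cn n → ℝ) (L : ℕ → Cn n → Cn n) (a : Cn n → Cn n) : Prop where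
  smooth : SmoothNear a x
  tangent : ∀ᶠ y in 𝓝 x, (CVectorField.ofHol a).apply (toC r) y = 0
  levi : ∀ j, 2 ≤ j → j ≤ p + 1 → ∀ᶠ y in 𝓝 x, leviForm r y (a y) (L j y) = 0
  kill : ∀ i, p + 2 ≤ i → i < k →
    ∀ᶠ y in 𝓝 x, (CVectorField.ofHol a).apply (toC (R i)) y = 0

/-- The pairs of a vector field `L ∈ 𝒯_k` and an ordered, `k`-admissible list `ℒ` made of
`L_{p+2}, …, L_{k-1}, L` and their conjugates (the index `k` stands for `L`) for which
`ℒ∂r(x) ≠ 0`. -/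
def nonvanishingLists {n : ℕ} (r : Cn n → ℝ) (x : Cn n) (p k : ℕ)
    (R : ℕ → Cn n → ℝ) (L : ℕ → Cn n → Cn n) (c : ℕ → ℚ) :
    Set ((Cn n → Cn n) × FieldWord) :=
  {q | IsSectionNear r x p k R L q.1 ∧ q.2.IsOrderedAdmissible p k c ∧
    listDeriv r (q.2.fields (Function.update L k q.1)) x ≠ 0}

/-- The choice of `c_k`, `L_k`, `r_k` at the step `k ≥ p + 2` when some list does not vanish: there
is a list `ℒ_k` built with `L_k` that minimizes `c(ℒ)`, `c_k` is the minimum, and `r_k` is, near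
`x`, the real or the imaginary part of `ℒ'_k ∂r`, where `ℒ'_k` is `ℒ_k` without its first
member, with `L_k(r_k)(x) ≠ 0`. -/
def IsStep {n : ℕ} (r : Cn n → ℝ) (x : Cn n) (p k : ℕ)
    (R : ℕ → Cn n → ℝ) (L : ℕ → Cn n → Cn n) (c : ℕ → ℚ) : Prop :=
  ∃ w : FieldWord,
    (L k, w) ∈ nonvanishingLists r x p k R L c ∧
    c k = w.listWeight p k c ∧
    (∀ q ∈ nonvanishingLists r x p k R L c, c k ≤ q.2.listWeight p k c) ∧
    ((R k =ᶠ[𝓝 x] fun y => (listDeriv r (FieldWord.fields L w.tail) y).re) ∨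
      (R k =ᶠ[𝓝 x] fun y => (listDeriv r (FieldWord.fields L w.tail) y).im)) ∧
    (CVectorField.ofHol (L k)).apply (toC (R k)) x ≠ 0

/-- `{r, r_{p+2}, …, r_μ; L_2, …, L_μ}` is a boundary system of rank `p` and codimension `n - μ` at
`x`, where `μ ≥ p + 1`, and `c_1, …, c_μ` are the entries of the commutator multitype found in
constructing it. Only the values `R i` with `p + 2 ≤ i ≤ μ`, `L i` with `2 ≤ i ≤ μ` and `c i` with
`1 ≤ i ≤ μ` matter. -/
structure IsBoundarySystem {n : ℕ} (r : Cn n → ℝ) (x : Cn n) (p μ : ℕ)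
    (R : ℕ → Cn n → ℝ) (L : ℕ → Cn n → Cn n) (c : ℕ → ℚ) : Prop where
  rank_eq : leviRank r x = p
  le : p + 1 ≤ μ
  smooth : ∀ i, 2 ≤ i → i ≤ p + 1 → SmoothNear (L i) x
  tangent : ∀ i, 2 ≤ i → i ≤ p + 1 →
    ∀ᶠ y in 𝓝 x, (CVectorField.ofHol (L i)).apply (toC r) y = 0
  nonsingular :
    (Matrix.of fun i j : Fin p => leviForm r x (L (i + 2) x) (L (j + 2) x)).det ≠ 0
  c_one : c 1 = 1
  c_two : ∀ i, 2 ≤ i → i ≤ p + 1 → c i = 2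
  step : ∀ k, p + 2 ≤ k → k ≤ μ → IsStep r x p k R L c

/-- `C = (c_1, …, c_ν)` is a `ν`-th commutator multitype at `x`: its entries are produced by the
construction of a boundary system, which is continued until the `ν`-th entry is reached, or until
at the step `μ + 1` all lists vanish at `x`, in which case `c_{μ+1} = ⋯ = c_ν = ∞`. -/
def IsCommutatorMultitype {n : ℕ} (r : Cn n → ℝ) (x : Cn n) (ν : ℕ)
    (C : Lex (Fin ν → WithTop ℚ)) : Prop :=
  ∃ (p μ : ℕ) (R : ℕ → Cn n → ℝ) (L : ℕ → Cn n → Cn n) (c : ℕ → ℚ),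
    IsBoundarySystem r x p μ R L c ∧
    (ν ≤ μ ∨ nonvanishingLists r x p (μ + 1) R L c = ∅) ∧
    ∀ i : Fin ν, ofLex C i = if (i : ℕ) + 1 ≤ μ then ((c (i + 1) : ℚ) : WithTop ℚ) else ⊤

end

/-! At a point of Levi rank `p` the multitype begins with 1 and `p` entries 2, and the next entry
exceeds 2: in the first step past the Levi-nondegenerate directions every list consists of `L` and
its conjugate alone, so its weight is its length, at least 3. The Levi rank cannot drop nearby,
because a nonsingular minor stays nonsingular. Where it rises, an entry above 2 is replaced by 2,
and the multitype becomes lexicographically smaller. Hence at a point of lowest multitype the rank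
is locally constant on the boundary, provided the entry after the twos is among the first `ν`.

Constant rank makes all remaining entries infinite. A field `L` in the first class is tangential and
Levi-orthogonal to a maximal nondegenerate family, so by constancy of rank it takes values in the
Levi null space along the boundary. Then `∂r([L, L̄])` vanishes there, and tangential derivatives of
a function vanishing on the boundary vanish again; so every list vanishes
(`IsBoundarySystem.nonvanishingLists_eq_empty`). The multitype is therefore the same tuple of 1,
twos and infinities at all nearby boundary points. If instead the twos already fill all `ν` entries,
a rank that does not drop keeps the tuple unchanged. -/

/-! ### Linear algebra of the Levi rank. -/

/-- The Levi form with its second argument fixed, as a linear functional of the first. -/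
noncomputable def leviFunctional {n : ℕ} (r : Cn n → ℝ) (z b : Cn n) : Cn n →ₗ[ℂ] ℂ where
  toFun a := leviForm r z a b
  map_add' a a' := by
    simp only [leviForm, Pi.add_apply, mul_add, add_mul, Finset.sum_add_distrib]
  map_smul' c a := by
    simp only [leviForm, Pi.smul_apply, smul_eq_mul, Finset.mul_sum, RingHom.id_apply]
    refine Finset.sum_congr rfl fun j _ => Finset.sum_congr rfl fun k _ => ?_
    ring

/-- The Levi form against a family of vectors, restricted to the holomorphic tangent space. -/
noncomputable def leviPairing {n p : ℕ} (r : Cn n → ℝ) (z : Cn n) (V : Fin p → Cn n) :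
    holTangent r z →ₗ[ℂ] (Fin p → ℂ) :=
  LinearMap.pi fun j => (leviFunctional r z (V j)).comp (holTangent r z).subtype

theorem leviPairing_surjective {n p : ℕ} {r : Cn n → ℝ} {z : Cn n} {V : Fin p → Cn n}
    (hV : ∀ i, V i ∈ holTangent r z)
    (hdet : (Matrix.of fun i j : Fin p => leviForm r z (V i) (V j)).det ≠ 0) :
    Function.Surjective (leviPairing r z V) := by
  intro t
  set M := Matrix.of fun i j : Fin p => leviForm r z (V i) (V j) with hM
  set c := Matrix.vecMul t M⁻¹ with hc
  refine ⟨∑ i, c i • ⟨V i, hV i⟩, ?_⟩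
  have h1 : Matrix.vecMul c M = t := by
    rw [hc, Matrix.vecMul_vecMul, Matrix.nonsing_inv_mul _ (isUnit_iff_ne_zero.mpr hdet),
      Matrix.vecMul_one]
  rw [← h1, map_sum]
  ext j
  simp only [map_smul, Finset.sum_apply, Pi.smul_apply, smul_eq_mul, Matrix.vecMul, dotProduct]
  rfl

theorem comap_leviNull_le_ker {n p : ℕ} {r : Cn n → ℝ} {z : Cn n} {V : Fin p → Cn n}
    (hV : ∀ i, V i ∈ holTangent r z) :
    (leviNull r z).comap (holTangent r z).subtype ≤ LinearMap.ker (leviPairing r z V) := by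
  intro a ha
  rw [LinearMap.mem_ker]
  ext j
  exact ha.2 _ (hV j)

theorem finrank_comap_leviNull {n : ℕ} (r : Cn n → ℝ) (z : Cn n) :
    Module.finrank ℂ ((leviNull r z).comap (holTangent r z).subtype) =
      Module.finrank ℂ (leviNull r z) :=
  (Submodule.comapSubtypeEquivOfLe (p := leviNull r z) (q := holTangent r z)
    fun _ ha => ha.1).finrank_eq

theorem finrank_ker_leviPairing {n p : ℕ} {r : Cn n → ℝ} {z : Cn n} {V : Fin p → Cn n}
    (hV : ∀ i, V i ∈ holTangent r z)
    (hdet : (Matrix.of fun i j : Fin p => leviForm r z (V i) (V j)).det ≠ 0) :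
    p + Module.finrank ℂ (LinearMap.ker (leviPairing r z V)) =
      Module.finrank ℂ (holTangent r z) := by
  rw [← LinearMap.finrank_range_add_finrank_ker (leviPairing r z V),
    LinearMap.range_eq_top.mpr (leviPairing_surjective hV hdet), finrank_top,
    Module.finrank_fin_fun]

/-- The null space lies in the kernel of the pairing with `V`, which has codimension `p` because
that pairing is onto. -/
theorem le_leviRank {n p : ℕ} {r : Cn n → ℝ} {z : Cn n} {V : Fin p → Cn n}
    (hV : ∀ i, V i ∈ holTangent r z)
    (hdet : (Matrix.of fun i j : Fin p => leviForm r z (V i) (V j)).det ≠ 0) :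
    p ≤ leviRank r z := by
  have h1 := finrank_ker_leviPairing hV hdet
  have h2 := Submodule.finrank_mono (comap_leviNull_le_ker hV)
  rw [finrank_comap_leviNull] at h2
  unfold leviRank
  omega

/-- When the rank is exactly `p`, the null space and the kernel of the pairing have equal dimension,
so the inclusion between them is an equality. -/
theorem mem_leviNull_of_leviRank_eq {n p : ℕ} {r : Cn n → ℝ} {z : Cn n} {V : Fin p → Cn n}
    (hV : ∀ i, V i ∈ holTangent r z)
    (hdet : (Matrix.of fun i j : Fin p => leviForm r z (V i) (V j)).det ≠ 0)
    (hrank : leviRank r z = p) {a : Cn n} (ha : a ∈ holTangent r z)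
    (haV : ∀ j, leviForm r z a (V j) = 0) : a ∈ leviNull r z := by
  have h1 := finrank_ker_leviPairing hV hdet
  have h2 := comap_leviNull_le_ker hV
  have h3 := finrank_comap_leviNull r z
  have h5 := Submodule.finrank_mono h2
  unfold leviRank at hrank
  have h4 := Submodule.eq_of_le_of_finrank_eq h2 (by omega)
  have h6 : (⟨a, ha⟩ : holTangent r z) ∈ LinearMap.ker (leviPairing r z V) := by
    rw [LinearMap.mem_ker]
    ext j
    exact haV j
  rw [← h4] at h6
  exact h6

/-! ### Smoothness of list derivatives and continuity of the Levi form. -/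

section Smoothness

variable {n : ℕ} {u : Cn n → ℂ} {y : Cn n}

theorem ContDiffAt.wirtinger_dz (hu : ContDiffAt ℝ ∞ u y) (j : Fin n) :
    ContDiffAt ℝ ∞ (dz j u) y := by
  have h : ContDiffAt ℝ ∞ (fderiv ℝ u) y := hu.fderiv_right (by simp)
  exact contDiffAt_const.mul ((h.clm_apply contDiffAt_const).sub
    (contDiffAt_const.mul (h.clm_apply contDiffAt_const)))

theorem ContDiffAt.wirtinger_dzbar (hu : ContDiffAt ℝ ∞ u y) (j : Fin n) :
    ContDiffAt ℝ ∞ (dzbar j u) y := by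
  have h : ContDiffAt ℝ ∞ (fderiv ℝ u) y := hu.fderiv_right (by simp)
  exact contDiffAt_const.mul ((h.clm_apply contDiffAt_const).add
    (contDiffAt_const.mul (h.clm_apply contDiffAt_const)))

theorem ContDiffAt.toC {r : Cn n → ℝ} (hr : ContDiffAt ℝ ∞ r y) : ContDiffAt ℝ ∞ (toC r) y :=
  Complex.ofRealCLM.contDiff.contDiffAt.comp y hr

theorem ContDiffAt.conj_comp (hu : ContDiffAt ℝ ∞ u y) :
    ContDiffAt ℝ ∞ (fun z => conj (u z)) y :=
  Complex.conjCLE.contDiff.contDiffAt.comp y hu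

theorem CVectorField.contDiffAt_apply {X : CVectorField n} (hX : ContDiffAt ℝ ∞ X.hol y)
    (hX' : ContDiffAt ℝ ∞ X.anti y) (hu : ContDiffAt ℝ ∞ u y) :
    ContDiffAt ℝ ∞ (X.apply u) y := by
  refine ContDiffAt.sum fun j _ => ?_
  exact ((contDiffAt_pi.mp hX j).mul (hu.wirtinger_dz j)).add
    ((contDiffAt_pi.mp hX' j).mul (hu.wirtinger_dzbar j))

theorem CVectorField.contDiffAt_delForm_bracket {r : Cn n → ℝ} (hr : ContDiffAt ℝ ∞ r y)
    {X Y : CVectorField n} (hX : ContDiffAt ℝ ∞ X.hol y) (hX' : ContDiffAt ℝ ∞ X.anti y)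
    (hY : ContDiffAt ℝ ∞ Y.hol y) (hY' : ContDiffAt ℝ ∞ Y.anti y) :
    ContDiffAt ℝ ∞ (delForm r (X.bracket Y)) y := by
  refine ContDiffAt.sum fun j _ => (hr.toC.wirtinger_dz j).mul ?_
  exact (contDiffAt_apply hX hX' (contDiffAt_pi.mp hY j)).sub
    (contDiffAt_apply hY hY' (contDiffAt_pi.mp hX j))

theorem CVectorField.contDiffAt_signed {a : Cn n → Cn n} (ha : ContDiffAt ℝ ∞ a y) (s : Bool) :
    ContDiffAt ℝ ∞ (signed a s).hol y ∧ ContDiffAt ℝ ∞ (signed a s).anti y := by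
  cases s with
  | false => exact ⟨ha, contDiffAt_const⟩
  | true =>
    exact ⟨contDiffAt_const, contDiffAt_pi.mpr fun j => (contDiffAt_pi.mp ha j).conj_comp⟩

theorem contDiffAt_listDeriv {r : Cn n → ℝ} (hr : ContDiffAt ℝ ∞ r y) :
    ∀ l : List (CVectorField n),
      (∀ X ∈ l, ContDiffAt ℝ ∞ X.hol y ∧ ContDiffAt ℝ ∞ X.anti y) →
        ContDiffAt ℝ ∞ (listDeriv r l) y
  | [], _ => contDiffAt_const
  | [_], _ => contDiffAt_const
  | [X, Y], h => CVectorField.contDiffAt_delForm_bracket hr (h X (by simp)).1 (h X (by simp)).2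
      (h Y (by simp)).1 (h Y (by simp)).2
  | X :: Y :: Z :: t, h => CVectorField.contDiffAt_apply (h X (by simp)).1 (h X (by simp)).2
      (contDiffAt_listDeriv hr (Y :: Z :: t) fun V hV => h V (List.mem_cons_of_mem _ hV))

theorem continuousAt_leviForm {r : Cn n → ℝ} {a b : Cn n → Cn n} (hr : ContDiffAt ℝ ∞ r y)
    (ha : ContinuousAt a y) (hb : ContinuousAt b y) :
    ContinuousAt (fun z => leviForm r z (a z) (b z)) y := by
  refine tendsto_finsetSum _ fun j _ => tendsto_finsetSum _ fun k _ => ?_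
  exact (((hr.toC.wirtinger_dzbar k).wirtinger_dz j).continuousAt.mul
    (continuousAt_pi.mp ha j)).mul
      (Complex.continuous_conj.continuousAt.comp (continuousAt_pi.mp hb k))

end Smoothness

/-! ### Complex conjugation and Wirtinger derivatives. -/

section Conjugation

variable {n : ℕ}

theorem fderiv_conj_comp (u : Cn n → ℂ) (z w : Cn n) :
    fderiv ℝ (fun y => conj (u y)) z w = conj (fderiv ℝ u z w) := by
  have h := Complex.conjCLE.comp_fderiv (f := u) (x := z)
  exact DFunLike.congr_fun h w

theorem conj_dz (j : Fin n) (u : Cn n → ℂ) (z : Cn n) :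
    conj (dz j u z) = dzbar j (fun y => conj (u y)) z := by
  simp only [dz, dzbar, fderiv_conj_comp, map_mul, map_sub, conj_I, map_div₀, map_one, map_ofNat]
  ring

theorem conj_dzbar (j : Fin n) (u : Cn n → ℂ) (z : Cn n) :
    conj (dzbar j u z) = dz j (fun y => conj (u y)) z := by
  simp only [dz, dzbar, fderiv_conj_comp, map_mul, map_add, conj_I, map_div₀, map_one, map_ofNat]
  ring

theorem conj_toC (r : Cn n → ℝ) : (fun y => conj (toC r y)) = toC r := by
  ext y
  exact Complex.conj_ofReal _

theorem conj_ofHol_apply (a : Cn n → Cn n) (u : Cn n → ℂ) (z : Cn n) :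
    conj ((CVectorField.ofHol a).apply u z) =
      (CVectorField.ofHolConj a).apply (fun y => conj (u y)) z := by
  simp [CVectorField.apply, CVectorField.ofHol, CVectorField.ofHolConj, conj_dz]

theorem signed_apply_toC_eq_zero {r : Cn n → ℝ} {a : Cn n → Cn n} {z : Cn n}
    (h : (CVectorField.ofHol a).apply (toC r) z = 0) (s : Bool) :
    (CVectorField.signed a s).apply (toC r) z = 0 := by
  cases s with
  | false => exact h
  | true =>
    have h' := congrArg conj h
    rwa [conj_ofHol_apply, conj_toC, map_zero] at h'

theorem mem_holTangent_of_apply_eq_zero {r : Cn n → ℝ} {a : Cn n → Cn n} {z : Cn n}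
    (h : (CVectorField.ofHol a).apply (toC r) z = 0) : a z ∈ holTangent r z := by
  simpa [CVectorField.apply, CVectorField.ofHol, holTangent, mul_comm] using h

end Conjugation

/-! ### The commutator of a field with its conjugate, and the Levi form. -/

section Derivation

variable {n : ℕ}

theorem dz_mul {f g : Cn n → ℂ} {y : Cn n} (hf : DifferentiableAt ℝ f y)
    (hg : DifferentiableAt ℝ g y) (j : Fin n) :
    dz j (fun z => f z * g z) y = dz j f y * g y + f y * dz j g y := by
  simp only [dz, fderiv_fun_mul hf hg, add_apply,
    smul_apply, smul_eq_mul]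
  ring

theorem dz_sum {ι : Type*} (s : Finset ι) {f : ι → Cn n → ℂ} {y : Cn n}
    (hf : ∀ i ∈ s, DifferentiableAt ℝ (f i) y) (j : Fin n) :
    dz j (fun z => ∑ i ∈ s, f i z) y = ∑ i ∈ s, dz j (f i) y := by
  simp only [dz, fderiv_fun_sum hf, sum_apply, Finset.mul_sum,
    Finset.sum_sub_distrib, mul_sub]

theorem Filter.EventuallyEq.dz_eq {f g : Cn n → ℂ} {y : Cn n} (h : f =ᶠ[𝓝 y] g) (j : Fin n) :
    dz j f y = dz j g y := by
  simp only [dz, h.fderiv_eq]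

theorem dz_zero (j : Fin n) (y : Cn n) : dz j (fun _ => 0) y = 0 := by
  simp [dz]

/-- Differentiate the conjugated tangency identity `L̄ r = 0` by `∂/∂z_j`, multiply by `a_j` and
sum. Conjugating the left side produces the derivatives in the order used by `leviForm`, so symmetry
of mixed partials is not needed. -/
theorem conj_delForm_bracket_signed {r : Cn n → ℝ} {a : Cn n → Cn n} {y : Cn n}
    (hr : ContDiffAt ℝ ∞ r y) (ha : ContDiffAt ℝ ∞ a y)
    (htan : ∀ᶠ z in 𝓝 y, (CVectorField.ofHol a).apply (toC r) z = 0) :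
    conj (delForm r ((CVectorField.ofHol a).bracket (CVectorField.ofHolConj a)) y) =
      leviForm r y (a y) (a y) := by
  have hF : (fun z => ∑ k, conj (a z k) * dzbar k (toC r) z) =ᶠ[𝓝 y] fun _ => 0 := by
    filter_upwards [htan] with z hz
    have h := signed_apply_toC_eq_zero hz true
    simpa [CVectorField.signed, CVectorField.ofHolConj, CVectorField.apply] using h
  have hda : ∀ k, DifferentiableAt ℝ (fun z => conj (a z k)) y := fun k =>
    (contDiffAt_pi.mp ha k).conj_comp.differentiableAt (by simp)
  have hdr : ∀ k, DifferentiableAt ℝ (dzbar k (toC r)) y := fun k =>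
    (hr.toC.wirtinger_dzbar k).differentiableAt (by simp)
  have hj : ∀ j, ∑ k, (dz j (fun z => conj (a z k)) y * dzbar k (toC r) y +
      conj (a y k) * dz j (dzbar k (toC r)) y) = 0 := by
    intro j
    have h := hF.dz_eq j
    rw [dz_zero, dz_sum _ fun k _ => (hda k).fun_mul (hdr k)] at h
    rw [← h]
    exact Finset.sum_congr rfl fun k _ => (dz_mul (hda k) (hdr k) j).symm
  have hsum : ∑ j, a y j * ∑ k, (dz j (fun z => conj (a z k)) y * dzbar k (toC r) y +
      conj (a y k) * dz j (dzbar k (toC r)) y) = 0 := by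
    simp [hj]
  simp only [Finset.mul_sum, mul_add, Finset.sum_add_distrib] at hsum
  have hdel : conj (delForm r ((CVectorField.ofHol a).bracket (CVectorField.ofHolConj a)) y) =
      -∑ j, ∑ k, a y j * (dz j (fun z => conj (a z k)) y * dzbar k (toC r) y) := by
    rw [Finset.sum_comm]
    simp [delForm, CVectorField.bracket, CVectorField.ofHol, CVectorField.ofHolConj,
      CVectorField.apply, conj_dz, conj_dzbar, conj_toC, dz_zero, Finset.mul_sum]
    refine Finset.sum_congr rfl fun j _ => Finset.sum_congr rfl fun k _ => ?_
    ring
  have hlevi : leviForm r y (a y) (a y) =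
      ∑ j, ∑ k, a y j * (conj (a y k) * dz j (dzbar k (toC r)) y) := by
    refine Finset.sum_congr rfl fun j _ => Finset.sum_congr rfl fun k _ => ?_
    ring
  rw [hdel, hlevi]
  exact (eq_neg_of_add_eq_zero_right hsum).symm

theorem delForm_bracket_swap (r : Cn n → ℝ) (X Y : CVectorField n) (y : Cn n) :
    delForm r (X.bracket Y) y = -delForm r (Y.bracket X) y := by
  simp only [delForm, CVectorField.bracket, ← Finset.sum_neg_distrib]
  exact Finset.sum_congr rfl fun j _ => by ring

theorem delForm_bracket_signed_eq_zero {r : Cn n → ℝ} {a : Cn n → Cn n} {y : Cn n}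
    (hr : ContDiffAt ℝ ∞ r y) (ha : ContDiffAt ℝ ∞ a y)
    (htan : ∀ᶠ z in 𝓝 y, (CVectorField.ofHol a).apply (toC r) z = 0)
    (hlevi : leviForm r y (a y) (a y) = 0) (s t : Bool) :
    delForm r ((CVectorField.signed a s).bracket (CVectorField.signed a t)) y = 0 := by
  have hself : ∀ X : CVectorField n, delForm r (X.bracket X) y = 0 := fun X => by
    simp [delForm, CVectorField.bracket]
  have h : delForm r ((CVectorField.ofHol a).bracket (CVectorField.ofHolConj a)) y = 0 := by
    rw [← map_eq_zero (starRingEnd ℂ), conj_delForm_bracket_signed hr ha htan, hlevi]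
  cases s <;> cases t
  · exact hself _
  · exact h
  · exact (delForm_bracket_swap r _ _ y).trans (by rw [CVectorField.signed, CVectorField.signed, h,
      neg_zero])
  · exact hself _

end Derivation

/-! ### Functions vanishing on the hypersurface `{r = 0}`. -/

section LevelSet

variable {n : ℕ}

/-- A function that is constant on a level set has an extremum there at every point, so Lagrange
multipliers apply. -/
theorem exists_fderiv_eq_smul_of_eq_zero_on_level {E : Type*} [NormedAddCommGroup E]
    [NormedSpace ℝ E] [CompleteSpace E] {f φ : E → ℝ} {y : E} (hf : ContDiffAt ℝ ∞ f y)
    (hφ : ContDiffAt ℝ ∞ φ y) (hdf : fderiv ℝ f y ≠ 0) (hy : f y = 0)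
    (hzero : ∀ᶠ z in 𝓝 y, f z = 0 → φ z = 0) : ∃ c : ℝ, fderiv ℝ φ y = c • fderiv ℝ f y := by
  have hφy : φ y = 0 := hzero.self_of_nhds hy
  have hext : IsLocalExtrOn φ {z | f z = f y} y := by
    refine Or.inl ?_
    filter_upwards [eventually_nhdsWithin_of_eventually_nhds hzero, self_mem_nhdsWithin] with z hz hz'
    rw [hφy, hz (hz'.trans hy)]
  obtain ⟨b, d, hbd, h⟩ := hext.exists_multipliers_of_hasStrictFDerivAt_1d
    (hf.hasStrictFDerivAt (by simp)) (hφ.hasStrictFDerivAt (by simp))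
  -- With `d = 0` the relation would read `b • df = 0`, and both multipliers would vanish.
  have hd : d ≠ 0 := by
    rintro rfl
    have hb : b = 0 := by simpa [hdf] using h
    exact hbd (by rw [hb]; rfl)
  refine ⟨-b / d, ?_⟩
  have h' : d • fderiv ℝ φ y = (-b) • fderiv ℝ f y := by
    rw [neg_smul]
    exact eq_neg_of_add_eq_zero_right h
  rw [div_eq_inv_mul, mul_smul, ← h', smul_smul, inv_mul_cancel₀ hd, one_smul]

theorem fderiv_toC {r : Cn n → ℝ} {y : Cn n} (hr : DifferentiableAt ℝ r y) (w : Cn n) :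
    fderiv ℝ (toC r) y w = (fderiv ℝ r y w : ℂ) := by
  have h := (Complex.ofRealCLM.hasFDerivAt.comp y hr.hasFDerivAt).fderiv
  exact DFunLike.congr_fun h w

/-- If `u` vanishes on the hypersurface `{r = 0}`, then `X u` vanishes wherever `X` is tangent. -/
theorem CVectorField.apply_eq_zero_of_eq_zero_on_level {r : Cn n → ℝ} {u : Cn n → ℂ} {y : Cn n}
    (hr : ContDiffAt ℝ ∞ r y) (hu : ContDiffAt ℝ ∞ u y) (hdr : fderiv ℝ r y ≠ 0)
    (hy : r y = 0) (hzero : ∀ᶠ z in 𝓝 y, r z = 0 → u z = 0) {X : CVectorField n}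
    (hX : X.apply (toC r) y = 0) : X.apply u y = 0 := by
  obtain ⟨c, hc⟩ := exists_fderiv_eq_smul_of_eq_zero_on_level hr
    (Complex.reCLM.contDiff.contDiffAt.comp y hu) hdr hy
    (hzero.mono fun z hz h => by simp [hz h])
  obtain ⟨d, hd⟩ := exists_fderiv_eq_smul_of_eq_zero_on_level hr
    (Complex.imCLM.contDiff.contDiffAt.comp y hu) hdr hy
    (hzero.mono fun z hz h => by simp [hz h])
  have hu' : DifferentiableAt ℝ u y := hu.differentiableAt (by simp)
  have key : ∀ w, fderiv ℝ u y w = (c + d * I) * fderiv ℝ (toC r) y w := by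
    intro w
    rw [(Complex.reCLM.hasFDerivAt.comp y hu'.hasFDerivAt).fderiv] at hc
    rw [(Complex.imCLM.hasFDerivAt.comp y hu'.hasFDerivAt).fderiv] at hd
    have hc' : (fderiv ℝ u y w).re = c * fderiv ℝ r y w := DFunLike.congr_fun hc w
    have hd' : (fderiv ℝ u y w).im = d * fderiv ℝ r y w := DFunLike.congr_fun hd w
    rw [fderiv_toC (hr.differentiableAt (by simp)), ← Complex.re_add_im (fderiv ℝ u y w), hc', hd']
    push_cast
    ring
  have happ : X.apply u y = (c + d * I) * X.apply (toC r) y := by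
    simp only [apply, dz, dzbar, key, Finset.mul_sum]
    exact Finset.sum_congr rfl fun j _ => by ring
  rw [happ, hX, mul_zero]

theorem fderiv_ne_zero_eventually {r : Cn n → ℝ} {x : Cn n} (hr : SmoothNear r x)
    (hdr : fderiv ℝ r x ≠ 0) : ∀ᶠ y in 𝓝 x, fderiv ℝ r y ≠ 0 := by
  have h : ContDiffAt ℝ ∞ (fderiv ℝ r) x := hr.self_of_nhds.fderiv_right (by simp)
  exact h.continuousAt.eventually_ne hdr

/-- If the Levi form of a tangential field vanishes along `{r = 0}`, then so do all the list
derivatives built from the field and its conjugate. -/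
theorem listDeriv_signed_eq_zero_on_level {r : Cn n → ℝ} {x : Cn n} {a : Cn n → Cn n}
    (hr : SmoothNear r x) (hdr : fderiv ℝ r x ≠ 0) (ha : SmoothNear a x)
    (htan : ∀ᶠ y in 𝓝 x, (CVectorField.ofHol a).apply (toC r) y = 0)
    (hlevi : ∀ᶠ y in 𝓝 x, r y = 0 → leviForm r y (a y) (a y) = 0) :
    ∀ l : List Bool,
      ∀ᶠ y in 𝓝 x, r y = 0 → listDeriv r (l.map (CVectorField.signed a)) y = 0
  | [] => Eventually.of_forall fun _ _ => rfl
  | [_] => Eventually.of_forall fun _ _ => rfl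
  | [s, t] => by
    filter_upwards [hr, ha, htan.eventually_nhds, hlevi] with y h1 h2 h3 h4 hy
    exact delForm_bracket_signed_eq_zero h1 h2 h3 (h4 hy) s t
  | s :: t :: v :: l => by
    have ih := listDeriv_signed_eq_zero_on_level hr hdr ha htan hlevi (t :: v :: l)
    -- The outer field differentiates at `y`, so the induction hypothesis is needed on a whole
    -- neighbourhood of `y`.
    filter_upwards [hr, ha, htan, ih.eventually_nhds, fderiv_ne_zero_eventually hr hdr]
      with y h1 h2 h3 h4 h5 hy
    refine CVectorField.apply_eq_zero_of_eq_zero_on_level h1 ?_ h5 hy h4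
      (signed_apply_toC_eq_zero h3 s)
    refine contDiffAt_listDeriv h1 ((t :: v :: l).map (CVectorField.signed a)) fun X hX => ?_
    obtain ⟨b, -, rfl⟩ := List.mem_map.mp hX
    exact CVectorField.contDiffAt_signed h2 b

end LevelSet

/-! ### The boundary as the zero set of `r`. -/

section Boundary

variable {n : ℕ} {Ω : Set (Cn n)} {r : Cn n → ℝ} {x : Cn n}

theorem IsDefiningFunction.smoothNear (hr : IsDefiningFunction Ω r) (hx : x ∈ frontier Ω) :
    SmoothNear r x := by
  obtain ⟨W, hWo, hW, hs, -, -⟩ := hr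
  filter_upwards [hWo.mem_nhds (hW hx)] with y hy
  exact hs.contDiffAt (hWo.mem_nhds hy)

theorem IsDefiningFunction.fderiv_ne_zero (hr : IsDefiningFunction Ω r) (hx : x ∈ frontier Ω) :
    fderiv ℝ r x ≠ 0 := by
  obtain ⟨W, -, -, -, -, h⟩ := hr
  exact h x hx

theorem IsDefiningFunction.eq_zero (hr : IsDefiningFunction Ω r) (hΩ : IsOpen Ω)
    (hx : x ∈ frontier Ω) : r x = 0 := by
  have hcont := (hr.smoothNear hx).self_of_nhds.continuousAt
  obtain ⟨W, hWo, hW, hs, heq, -⟩ := hr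
  have hxW := hW hx
  rw [hΩ.frontier_eq] at hx
  refine le_antisymm ?_ ?_
  · by_contra! hlt
    obtain ⟨y, ⟨hy1, hy2⟩, hyΩ⟩ := mem_closure_iff_nhds.mp hx.1 _
      (inter_mem (hcont.eventually (lt_mem_nhds hlt)) (hWo.mem_nhds hxW))
    have h : y ∈ {z ∈ W | r z < 0} := heq ▸ ⟨hyΩ, hy2⟩
    exact lt_asymm hy1 h.2
  · by_contra! hlt
    have h : x ∈ Ω ∩ W := heq ▸ ⟨hxW, hlt⟩
    exact hx.2 h.1

/-- Otherwise `x` would be a local minimum of `r`, and the derivative would vanish. -/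
theorem mem_closure_neg_of_fderiv_ne_zero (hdr : fderiv ℝ r x ≠ 0)
    (hx : r x = 0) : x ∈ closure {z | r z < 0} := by
  by_contra hcl
  have hmin : IsLocalMin r x := by
    filter_upwards [isClosed_closure.isOpen_compl.mem_nhds hcl] with z hz
    rw [hx]
    by_contra! hlt
    exact hz (subset_closure hlt)
  exact hdr hmin.fderiv_eq_zero

theorem IsDefiningFunction.mem_frontier_eventually (hr : IsDefiningFunction Ω r) (hΩ : IsOpen Ω)
    (hx : x ∈ frontier Ω) : ∀ᶠ y in 𝓝 x, r y = 0 → y ∈ frontier Ω := by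
  have h1 := hr.smoothNear hx
  have h2 := fderiv_ne_zero_eventually h1 (hr.fderiv_ne_zero hx)
  obtain ⟨W, hWo, hW, hs, heq, -⟩ := hr
  filter_upwards [h2, hWo.mem_nhds (hW hx)] with y hy2 hyW hy
  rw [hΩ.frontier_eq]
  refine ⟨?_, fun hyΩ => ?_⟩
  · have hcl := mem_closure_neg_of_fderiv_ne_zero hy2 hy
    refine mem_closure_iff_nhds.mpr fun t ht => ?_
    obtain ⟨z, ⟨hz1, hz2⟩, hz3⟩ := mem_closure_iff_nhds.mp hcl _ (inter_mem ht (hWo.mem_nhds hyW))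
    have h : z ∈ Ω ∩ W := heq ▸ ⟨hz2, hz3⟩
    exact ⟨z, hz1, h.1⟩
  · have h : y ∈ {z ∈ W | r z < 0} := heq ▸ ⟨hyΩ, hyW⟩
    exact h.2.ne hy

end Boundary

/-! ### The first step `k = p + 2` of a boundary system. -/

section BoundarySystem

variable {n p μ : ℕ} {r : Cn n → ℝ} {x : Cn n} {R : ℕ → Cn n → ℝ} {L : ℕ → Cn n → Cn n}
  {c : ℕ → ℚ}

theorem IsBoundarySystem.frame_eventually (h : IsBoundarySystem r x p μ R L c)
    (hr : SmoothNear r x) :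
    ∀ᶠ y in 𝓝 x, (∀ i : Fin p, L (i + 2) y ∈ holTangent r y) ∧
      (Matrix.of fun i j : Fin p => leviForm r y (L (i + 2) y) (L (j + 2) y)).det ≠ 0 := by
  refine Eventually.and (eventually_all.mpr fun i => ?_) ?_
  · filter_upwards [h.tangent (i + 2) (by omega) (by omega)] with y hy
    exact mem_holTangent_of_apply_eq_zero hy
  · have hL : ∀ i : Fin p, ContinuousAt (L (i + 2)) x := fun i =>
      (h.smooth (i + 2) (by omega) (by omega)).self_of_nhds.continuousAt
    have hM : ContinuousAt (fun y => Matrix.of fun i j : Fin p =>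
        leviForm r y (L (i + 2) y) (L (j + 2) y)) x :=
      continuousAt_pi.mpr fun i => continuousAt_pi.mpr fun j =>
        continuousAt_leviForm hr.self_of_nhds (hL i) (hL j)
    have hdet : ContinuousAt (fun y => (Matrix.of fun i j : Fin p =>
        leviForm r y (L (i + 2) y) (L (j + 2) y)).det) x :=
      (continuous_id.matrix_det.continuousAt).comp hM
    exact hdet.eventually_ne h.nonsingular

/-- Where the Levi rank is locally constant, all lists at the first step vanish. -/
theorem IsBoundarySystem.nonvanishingLists_eq_empty (h : IsBoundarySystem r x p μ R L c)
    (hr : SmoothNear r x) (hdr : fderiv ℝ r x ≠ 0) (hx : r x = 0)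
    (hrank : ∀ᶠ y in 𝓝 x, r y = 0 → leviRank r y = p) :
    nonvanishingLists r x p (p + 2) R L c = ∅ := by
  refine Set.eq_empty_of_forall_notMem ?_
  rintro ⟨a, w⟩ ⟨hsec, hadm, hne⟩
  simp only at hsec hadm hne
  have hlevi : ∀ᶠ y in 𝓝 x, r y = 0 → leviForm r y (a y) (a y) = 0 := by
    have hL : ∀ᶠ y in 𝓝 x, ∀ j : Fin p, leviForm r y (a y) (L (j + 2) y) = 0 :=
      eventually_all.mpr fun j => hsec.levi (j + 2) (by omega) (by omega)
    filter_upwards [h.frame_eventually hr, hrank, hsec.tangent, hL] with y h1 h2 h3 h4 hy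
    have ha := mem_holTangent_of_apply_eq_zero h3
    exact (mem_leviNull_of_leviRank_eq h1.1 h1.2 (h2 hy) ha h4).2 _ ha
  -- At this step the indices lie between `p + 2` and `p + 2`, so only `a` and its conjugate occur.
  have hw : w.fields (Function.update L (p + 2) a) =
      (w.map Prod.snd).map (CVectorField.signed a) := by
    rw [FieldWord.fields, List.map_map]
    refine List.map_congr_left fun b hb => ?_
    have hb' : b.1 = p + 2 := le_antisymm (hadm.index_mem b hb).2 (hadm.index_mem b hb).1
    simp [hb']
  rw [hw] at hne
  exact hne ((listDeriv_signed_eq_zero_on_level hr hdr hsec.smooth hsec.tangent hlevi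
    _).self_of_nhds hx)

/-- The weight sum is empty and every letter counts towards `l_{p+2}`, so `c (p + 2)` is the length
of the list. -/
theorem IsBoundarySystem.two_lt (h : IsBoundarySystem r x p μ R L c) (hμ : p + 2 ≤ μ) :
    2 < c (p + 2) := by
  obtain ⟨w, ⟨-, hadm, -⟩, hc, -⟩ := h.step (p + 2) le_rfl hμ
  have hlen : w.mult (p + 2) = w.length := by
    refine List.countP_eq_length.mpr fun b hb => ?_
    simpa using le_antisymm (hadm.index_mem b hb).2 (hadm.index_mem b hb).1
  have h3 : (3 : ℚ) ≤ w.length := by exact_mod_cast hadm.three_le_length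
  have hval : c (p + 2) = w.length := by
    rw [hc]
    simp [FieldWord.listWeight, FieldWord.weightSum, hlen]
  linarith

end BoundarySystem

/-! ### The multitype and the Levi rank. -/

section Multitype

variable {n ν : ℕ} {r : Cn n → ℝ} {x : Cn n} {C : Lex (Fin ν → WithTop ℚ)}

/-- The multitype at a point with Levi rank `p` when all lists vanish at the first step. -/
def rankMultitype (ν p : ℕ) : Fin ν → WithTop ℚ := fun i =>
  if (i : ℕ) = 0 then 1 else if (i : ℕ) ≤ p then 2 else ⊤

theorem IsCommutatorMultitype.eq_of_le_leviRank (h : IsCommutatorMultitype r x ν C) {i : Fin ν}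
    (hi : (i : ℕ) ≤ leviRank r x) : ofLex C i = rankMultitype ν (leviRank r x) i := by
  obtain ⟨p, μ, R, L, c, hb, -, hC⟩ := h
  have hle := hb.le
  rw [hb.rank_eq] at hi ⊢
  rw [hC, if_pos (by omega), rankMultitype]
  by_cases h0 : (i : ℕ) = 0
  · simp [h0, hb.c_one]
  · rw [if_neg h0, if_pos hi, hb.c_two _ (by omega) (by omega)]
    rfl

theorem IsCommutatorMultitype.two_lt (h : IsCommutatorMultitype r x ν C) {i : Fin ν}
    (hi : (i : ℕ) = leviRank r x + 1) : 2 < ofLex C i := by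
  obtain ⟨p, μ, R, L, c, hb, -, hC⟩ := h
  rw [hb.rank_eq] at hi
  rw [hC, hi]
  split_ifs with hμ
  · exact WithTop.coe_lt_coe.mpr (hb.two_lt hμ)
  · exact WithTop.coe_lt_top 2

theorem IsCommutatorMultitype.eq_rankMultitype (h : IsCommutatorMultitype r x ν C)
    (hr : SmoothNear r x) (hdr : fderiv ℝ r x ≠ 0) (hx : r x = 0)
    (hrank : ∀ᶠ y in 𝓝 x, r y = 0 → leviRank r y = leviRank r x) :
    ofLex C = rankMultitype ν (leviRank r x) := by
  funext i
  by_cases hi : (i : ℕ) ≤ leviRank r x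
  · exact h.eq_of_le_leviRank hi
  · obtain ⟨p, μ, R, L, c, hb, -, hC⟩ := h
    rw [hb.rank_eq] at hi hrank ⊢
    have hempty := hb.nonvanishingLists_eq_empty hr hdr hx hrank
    -- A step at `p + 2` would supply a nonvanishing list, so `μ = p + 1` and every later entry is
    -- `⊤`.
    have hμ : ¬ p + 2 ≤ μ := fun hμ => by
      obtain ⟨w, hw, -⟩ := hb.step (p + 2) le_rfl hμ
      simp [hempty] at hw
    rw [hC, if_neg (by omega), rankMultitype, if_neg (by omega), if_neg hi]

theorem IsCommutatorMultitype.leviRank_le_eventually (h : IsCommutatorMultitype r x ν C)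
    (hr : SmoothNear r x) : ∀ᶠ y in 𝓝 x, leviRank r x ≤ leviRank r y := by
  obtain ⟨p, μ, R, L, c, hb, -, -⟩ := h
  filter_upwards [hb.frame_eventually hr] with y hy
  rw [hb.rank_eq]
  exact le_leviRank hy.1 hy.2

/-- The first difference is at the zero-based index `leviRank r x + 1`: the entry there is 2 at `y`
and larger than 2 at `x`. -/
theorem IsCommutatorMultitype.lt_of_leviRank_lt {y : Cn n} {D : Lex (Fin ν → WithTop ℚ)}
    (hx : IsCommutatorMultitype r x ν C) (hy : IsCommutatorMultitype r y ν D)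
    (hlt : leviRank r x < leviRank r y) (hν : leviRank r x + 1 < ν) : D < C := by
  refine ⟨⟨leviRank r x + 1, hν⟩, fun j hj => ?_, ?_⟩
  · have hj' : (j : ℕ) < leviRank r x + 1 := hj
    refine (hy.eq_of_le_leviRank (by omega)).trans
      (Eq.trans ?_ (hx.eq_of_le_leviRank (by omega)).symm)
    simp only [rankMultitype]
    rw [if_pos (show (j : ℕ) ≤ leviRank r y by omega), if_pos (show (j : ℕ) ≤ leviRank r x by omega)]
  · refine lt_of_eq_of_lt ?_ (hx.two_lt (i := ⟨leviRank r x + 1, hν⟩) rfl)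
    refine (hy.eq_of_le_leviRank (i := ⟨leviRank r x + 1, hν⟩) hlt).trans ?_
    rw [rankMultitype, if_neg (Nat.succ_ne_zero _), if_pos (show leviRank r x + 1 ≤ _ from hlt)]

end Multitype

/-! ### Openness of the lowest level set. -/

theorem lemma4p9 {n : ℕ} (ν : ℕ) (hν : 2 ≤ ν) (hνn : ν ≤ n)
    (Ω : Set (Cn n)) (hΩo : IsOpen Ω) (hΩc : IsConnected Ω)
    (r : Cn n → ℝ) (hr : IsDefiningFunction Ω r)
    (x₀ : Cn n) (hx₀ : x₀ ∈ frontier Ω)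
    (U : Set (Cn n)) (hUo : IsOpen U) (hx₀U : x₀ ∈ U)
    (C : Cn n → Lex (Fin ν → WithTop ℚ))
    (hC : ∀ x ∈ U ∩ frontier Ω, IsCommutatorMultitype r x ν (C x))
    (N : ℕ) (hN : 1 ≤ N) (v : Fin N → Lex (Fin ν → WithTop ℚ)) (hv : StrictMono v)
    (hCv : C '' (U ∩ frontier Ω) = Set.range v)
    (S : Fin N → Set (Cn n))
    (hS : ∀ j, S j = {x ∈ U ∩ frontier Ω | C x = v j}) :
    IsOpen ((↑) ⁻¹' S ⟨0, hN⟩ : Set (frontier Ω)) := by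
  suffices h : ∀ x ∈ S ⟨0, hN⟩, ∀ᶠ y in 𝓝 x, y ∈ frontier Ω → y ∈ S ⟨0, hN⟩ by
    refine isOpen_iff_mem_nhds.mpr fun x hx => ?_
    filter_upwards [continuous_subtype_val.continuousAt.eventually (h x hx)] with y hy
    exact hy y.2
  intro x hxS
  rw [hS] at hxS ⊢
  obtain ⟨⟨hxU, hxb⟩, hxv⟩ := hxS
  have hmin : ∀ y ∈ U ∩ frontier Ω, C x ≤ C y := by
    intro y hy
    obtain ⟨j, hj⟩ : C y ∈ Set.range v := hCv ▸ Set.mem_image_of_mem C hy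
    rw [hxv, ← hj]
    exact hv.monotone (Nat.zero_le _)
  have hU := hUo.mem_nhds hxU
  have hCx := hC x ⟨hxU, hxb⟩
  have hlow := hCx.leviRank_le_eventually (hr.smoothNear hxb)
  suffices h : ∀ᶠ y in 𝓝 x, y ∈ frontier Ω → C y = C x by
    filter_upwards [hU, h] with y hyU hy hyb
    exact ⟨⟨hyU, hyb⟩, (hy hyb).trans hxv⟩
  by_cases hp : leviRank r x + 1 < ν
  · have hconst : ∀ᶠ y in 𝓝 x, y ∈ frontier Ω → leviRank r y = leviRank r x := by
      filter_upwards [hU, hlow] with y hyU hle hyb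
      refine le_antisymm (not_lt.mp fun hlt => ?_) hle
      exact (hmin y ⟨hyU, hyb⟩).not_gt (hCx.lt_of_leviRank_lt (hC y ⟨hyU, hyb⟩) hlt hp)
    -- Stated at a variable base point, since rank constancy near `x` also holds near each nearby
    -- `y`, and both multitypes are then computed in the same way.
    have heq : ∀ y ∈ U ∩ frontier Ω,
        (∀ᶠ z in 𝓝 y, z ∈ frontier Ω → leviRank r z = leviRank r x) →
          ofLex (C y) = rankMultitype ν (leviRank r x) := by
      intro y hy hrank
      have hself := hrank.self_of_nhds hy.2
      have h := (hC y hy).eq_rankMultitype (hr.smoothNear hy.2) (hr.fderiv_ne_zero hy.2)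
        (hr.eq_zero hΩo hy.2)
      rw [hself] at h
      refine h ?_
      filter_upwards [hrank, hr.mem_frontier_eventually hΩo hy.2] with z h1 h2 hz
      exact h1 (h2 hz)
    filter_upwards [hU, hconst.eventually_nhds] with y hyU hy hyb
    exact ofLex_inj.mp ((heq y ⟨hyU, hyb⟩ hy).trans (heq x ⟨hxU, hxb⟩ hconst).symm)
  -- Here `ν ≤ leviRank r x + 1`, so every index lies in the block of 1 and twos at both points.
  · filter_upwards [hU, hlow] with y hyU hle hyb
    refine ofLex_inj.mp (funext fun i => ?_)
    have hi := i.2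
    rw [hCx.eq_of_le_leviRank (by omega), (hC y ⟨hyU, hyb⟩).eq_of_le_leviRank (by omega)]
    simp only [rankMultitype]
    rw [if_pos (show (i : ℕ) ≤ leviRank r y by omega), if_pos (show (i : ℕ) ≤ leviRank r x by omega)]
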